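/- All regular spaces are understood to satisfy $T_1$ (i.e. "regular" means $T_3$). A space $Y$ has *countable extent* if every uncountable subset of $Y$ has an accumulation point in $Y$. A space $X$ is *(countable extent)-generated* if a set $A\subseteq X$ is open in $X$ whenever $A\cap Y$ is open in $Y$ for every subspace $Y\subseteq X$ of countable extent. The *dispersion character* $\Delta(X)$ of a nonempty space $X$ is the smallest cardinality of a nonempty open subset of $X$, and $X$ is *$\kappa$-resolvable* if it has $\kappa$ many pairwise disjoint dense subsets. **Theorem.** Let $X$ be a nonempty regular (countable extent)-generated space with $\Delta(X)>\omega$, i.e. all of whose nonempty open subsets are uncountable. Then $X$ is $\omega$-resolvable: it has infinitely (countably infinitely) many pairwise disjoint dense subsets. -/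

import Mathlib

open Cardinal Topology Filter

universe u

/-- A space has countable extent if every uncountable subset has an accumulation point in the
space. (For `T₁` spaces: every closed discrete subset is countable.) -/
def HasCountableExtent (X : Type u) [TopologicalSpace X] : Prop :=
  ∀ A : Set X, ¬ A.Countable → ∃ x : X, AccPt x (𝓟 A)

/-- `X` is (countable extent)-generated: its topology is determined by its subspaces of countable
extent, i.e. `A ⊆ X` is open as soon as `A ∩ Y` is open in `Y` for every subspace `Y` of countable
extent. -/
def IsCountableExtentGenerated (X : Type u) [TopologicalSpace X] : Prop :=
  IsCoherentWith {Y : Set X | HasCountableExtent Y}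

/-- The dispersion character `Δ(X)`: the smallest cardinality of a nonempty open subset of `X`
(with value `0` if `X` is empty). -/
noncomputable def dispersionCharacter (X : Type u) [TopologicalSpace X] : Cardinal.{u} :=
  sInf {c : Cardinal.{u} | ∃ U : Set X, IsOpen U ∧ U.Nonempty ∧ #U = c}

/-- `X` is `κ`-resolvable: it has `κ` many pairwise disjoint dense subsets. -/
def IsResolvable (κ : Cardinal.{u}) (X : Type u) [TopologicalSpace X] : Prop :=
  ∃ 𝒟 : Set (Set X), #𝒟 = κ ∧ (∀ D ∈ 𝒟, Dense D) ∧ 𝒟.PairwiseDisjoint id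

/-! By Zorn's lemma it is enough that every nonempty open `V` contains a nonempty set split into
countably many mutually dense pieces (`isResolvable_of_containsResolvable`). Fix an infinite `μ` and
call a set small if its size is at most `μ`. Either `V` contains such pieces, or `V` carries an
ordinal rank with small fibres for which no point is a limit of a small set of points of higher rank
(`containsResolvable_or_exists_rank`).

Given a rank, iterate "is a limit of lower-rank points of the previous set". If all iterates are
dense in `V`, their successive differences are the pieces. Otherwise, on some open `V'`, a dense set
has no small subset accumulating at a point of different rank. If every nonempty open subset of `V`
has more than `μ` points, generation by countable extent then yields an uncountable rank-injective
`A`, inside a subspace of countable extent, with closure in `V'`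
(`exists_uncountable_rank_discrete`).

If all nonempty open subsets of `V` exceed `ℵ₁`, take `μ = ℵ₁`: a subset of `A` of size `ℵ₁`
accumulates somewhere, a contradiction. Otherwise shrink to `#V ≤ ℵ₁` and take `μ = ℵ₀`: every
uncountable subset of `A` has a condensation point. Almost disjoint families of `ℵ₂` uncountable
sets then give the pieces (`containsResolvable_of_condensation`). -/

/-! ### Unions of few small sets. -/

section CardinalBounds

variable {X ι : Type u} {μ : Cardinal.{u}}

theorem mk_biUnion_le_of_le (hμ : ℵ₀ ≤ μ) {s : Set ι} {f : ι → Set X} (hs : #s ≤ μ)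
    (hf : ∀ i ∈ s, #(f i) ≤ μ) : #(⋃ i ∈ s, f i : Set X) ≤ μ := by
  calc #(⋃ i ∈ s, f i : Set X) ≤ #s * ⨆ i : s, #(f i) := Cardinal.mk_biUnion_le f s
    _ ≤ μ * μ := mul_le_mul' hs (ciSup_le' fun i => hf i i.2)
    _ = μ := Cardinal.mul_eq_self hμ

theorem mk_iUnion_nat_le_of_le (hμ : ℵ₀ ≤ μ) {f : ℕ → Set X} (hf : ∀ n, #(f n) ≤ μ) :
    #(⋃ n, f n : Set X) ≤ μ := by
  have h : (⋃ n, f n : Set X) = ⋃ i ∈ (Set.univ : Set (ULift.{u} ℕ)), f i.down := by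
    ext x
    simp [ULift.exists]
  rw [h]
  refine mk_biUnion_le_of_le hμ ?_ fun i _ => hf _
  simpa using hμ

theorem mk_union_le_of_le (hμ : ℵ₀ ≤ μ) {s t : Set X} (hs : #s ≤ μ) (ht : #t ≤ μ) :
    #(s ∪ t : Set X) ≤ μ :=
  (Cardinal.mk_union_le s t).trans (Cardinal.add_le_of_le hμ hs ht)

theorem mk_singleton_le_of_aleph0_le (hμ : ℵ₀ ≤ μ) (x : X) : #({x} : Set X) ≤ μ := by
  rw [Cardinal.mk_singleton]
  exact Cardinal.one_le_aleph0.trans hμ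

theorem mk_empty_le (μ : Cardinal.{u}) : #(∅ : Set X) ≤ μ := by simp

end CardinalBounds

/-! ### Mutually dense pieces, ranks and the limit tower. -/

section Pieces

variable {X : Type u} [TopologicalSpace X]

/-- `V` contains a nonempty set which is partitioned into countably many pieces, each dense in
the union of all of them. -/
def ContainsResolvable (V : Set X) : Prop :=
  ∃ E : ℕ → Set X, (∀ i, E i ⊆ V) ∧ (E 0).Nonempty ∧
    Pairwise (Function.onFun Disjoint E) ∧ ∀ i j, E i ⊆ closure (E j)

theorem ContainsResolvable.mono {V W : Set X} (h : ContainsResolvable V) (hVW : V ⊆ W) :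
    ContainsResolvable W := by
  obtain ⟨E, h1, h2⟩ := h
  exact ⟨E, fun i => (h1 i).trans hVW, h2⟩

/-- `C` is a subset of `V` closed in `V` under limits of sets of size at most `μ`. -/
def ClosedUnderSmall (μ : Cardinal.{u}) (V C : Set X) : Prop :=
  C ⊆ V ∧ ∀ N ⊆ C, #N ≤ μ → closure N ∩ V ⊆ C

/-- The transfinite sequence of sets obtained by repeatedly removing from `V` the set which `D`
selects from the remaining points. -/
noncomputable def peel (D : Set X → Set X) (V : Set X) (α : Ordinal.{u}) : Set X :=
  D (V \ ⋃ β : Set.Iio α, peel D V β.1)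
termination_by α
decreasing_by exact β.2

/-- The rank of a point is the stage at which it is peeled off. What remains after each stage is
still closed under small limits, so a small set of later points cannot reach back to a point already
removed. -/
theorem exists_rank_of_selectors {μ : Cardinal.{u}} {V : Set X}
    (h : ∀ C, ClosedUnderSmall μ V C → C.Nonempty →
      ∃ D ⊆ C, D.Nonempty ∧ #D ≤ μ ∧ ClosedUnderSmall μ V (C \ D)) :
    ∃ e : X → Ordinal.{u}, (∀ α, #{x ∈ V | e x = α} ≤ μ) ∧
      ∀ q ∈ V, ∀ N ⊆ V, #N ≤ μ → (∀ x ∈ N, e q < e x) → q ∉ closure N := by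
  have h' : ∀ C : Set X, ∃ D ⊆ C, #D ≤ μ ∧ (ClosedUnderSmall μ V C →
      ClosedUnderSmall μ V (C \ D) ∧ (C.Nonempty → D.Nonempty)) := by
    intro C
    by_cases hC : ClosedUnderSmall μ V C ∧ C.Nonempty
    · obtain ⟨D, h1, h2, h3, h4⟩ := h C hC.1 hC.2
      exact ⟨D, h1, h3, fun _ => ⟨h4, fun _ => h2⟩⟩
    · refine ⟨∅, Set.empty_subset _, by simp, fun hc => ⟨by simpa using hc, fun hn => ?_⟩⟩
      exact absurd ⟨hc, hn⟩ hC
  choose D hDC hDμ hD using h'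
  set R := peel D V with hR
  set C : Ordinal.{u} → Set X := fun α => V \ ⋃ β : Set.Iio α, R β.1 with hCdef
  have hRC : ∀ α, R α = D (C α) := fun α => by rw [hR, peel]
  have memC : ∀ α x, x ∈ C α ↔ x ∈ V ∧ ∀ β < α, x ∉ R β := by
    intro α x
    simp [hCdef]
  have hC : ∀ α, ClosedUnderSmall μ V (C α) := by
    intro α
    induction α using WellFoundedLT.induction with
    | ind α ih =>
      refine ⟨Set.sdiff_subset, fun N hN hNμ y hy => (memC α y).2 ⟨hy.2, fun β hβ => ?_⟩⟩
      have h1 := ((hD (C β)) (ih β hβ)).1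
      rw [← hRC] at h1
      refine (h1.2 N (fun x hx => ?_) hNμ hy).2
      have := (memC α x).1 (hN hx)
      exact ⟨(memC β x).2 ⟨this.1, fun γ hγ => this.2 γ (hγ.trans hβ)⟩, this.2 β hβ⟩
  have hdisj : ∀ α β x, x ∈ R α → x ∈ R β → α = β := by
    have key : ∀ α β x, x ∈ R α → x ∈ R β → ¬ β < α := by
      intro α β x ha hb hlt
      rw [hRC] at ha
      exact ((memC α x).1 (hDC _ ha)).2 β hlt hb
    intro α β x ha hb
    exact le_antisymm (not_lt.1 (key α β x ha hb)) (not_lt.1 (key β α x hb ha))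
  -- Otherwise the disjoint nonempty layers would inject all ordinals into `X`.
  have hend : ∃ α, C α = ∅ := by
    by_contra! hne
    have : ∀ α, (R α).Nonempty := fun α => by
      rw [hRC]
      exact ((hD (C α)) (hC α)).2 (hne α)
    choose f hf using this
    exact not_injective_of_ordinal f fun α β hab => hdisj α β (f α) (hf α) (hab ▸ hf β)
  obtain ⟨α₀, hα₀⟩ := hend
  have hex : ∀ x, ∃ α, x ∈ V → x ∈ R α := by
    intro x
    by_contra! hx
    have : x ∈ C α₀ := (memC _ x).2 ⟨(hx 0).1, fun β _ => (hx β).2⟩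
    simp [hα₀] at this
  choose e he using hex
  refine ⟨e, fun α => ?_, fun q hq N hN hNμ hlt hqN => ?_⟩
  · refine (Cardinal.mk_le_mk_of_subset (t := R α) ?_).trans (by rw [hRC]; exact hDμ _)
    rintro x ⟨hx, rfl⟩
    exact he x hx
  · have : q ∈ C (Order.succ (e q)) := by
      refine (hC _).2 N (fun x hx => (memC _ x).2 ⟨hN hx, fun β hβ hxβ => ?_⟩) hNμ ⟨hqN, hq⟩
      have h1 := hdisj _ _ x hxβ (he x (hN hx))
      have h2 := hlt x hx
      rw [← h1] at h2
      exact absurd (Order.lt_succ_iff.1 hβ) (not_le.2 h2)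
    exact ((memC _ q).1 this).2 (e q) (Order.lt_succ _) (he q hq)

/-- Build disjoint small layers, each in the closure of the next and hence of all later ones.
Distributing the layers over infinitely many infinite classes by `Nat.pair` gives the pieces. -/
theorem containsResolvable_of_small_limits {μ : Cardinal.{u}} (hμ : ℵ₀ ≤ μ) {C : Set X}
    (hC : C.Nonempty)
    (h : ∀ g ∈ C, ∀ F : Set X, #F ≤ μ → ∃ N ⊆ C \ F, #N ≤ μ ∧ g ∈ closure N) :
    ContainsResolvable C := by
  obtain ⟨p, hp⟩ := hC
  have hstep : ∀ F D : Set X, ∃ N, #F ≤ μ → #D ≤ μ → D ⊆ C →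
      N ⊆ C \ F ∧ #N ≤ μ ∧ D ⊆ closure N := by
    intro F D
    by_cases hFD : #F ≤ μ ∧ #D ≤ μ ∧ D ⊆ C
    · have : ∀ g, ∃ N : Set X, g ∈ D → N ⊆ C \ F ∧ #N ≤ μ ∧ g ∈ closure N := by
        intro g
        by_cases hg : g ∈ D
        · obtain ⟨N, hN⟩ := h g (hFD.2.2 hg) F hFD.1
          exact ⟨N, fun _ => hN⟩
        · exact ⟨∅, fun hg' => absurd hg' hg⟩
      choose N hN using this
      refine ⟨⋃ g ∈ D, N g, fun _ _ _ => ⟨Set.iUnion₂_subset fun g hg => (hN g hg).1,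
        mk_biUnion_le_of_le hμ hFD.2.1 fun g hg => (hN g hg).2.1, fun g hg => ?_⟩⟩
      exact closure_mono (Set.subset_biUnion_of_mem hg) (hN g hg).2.2
    · exact ⟨∅, fun h1 h2 h3 => absurd ⟨h1, h2, h3⟩ hFD⟩
  choose N hN using hstep
  -- The pair is the current layer and the union of all earlier layers.
  let s : ℕ → Set X × Set X := fun n =>
    Nat.rec ({p}, ∅) (fun _ s => (N (s.2 ∪ s.1) s.1, s.2 ∪ s.1)) n
  have hs : ∀ n, s (n + 1) = (N ((s n).2 ∪ (s n).1) (s n).1, (s n).2 ∪ (s n).1) := fun _ => rfl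
  have hinv : ∀ n, #(s n).1 ≤ μ ∧ #(s n).2 ≤ μ ∧ (s n).1 ⊆ C := by
    intro n
    induction n with
    | zero =>
      exact ⟨mk_singleton_le_of_aleph0_le hμ p, mk_empty_le μ, Set.singleton_subset_iff.2 hp⟩
    | succ n ih =>
      have hu := mk_union_le_of_le hμ ih.2.1 ih.1
      have := hN _ _ hu ih.1 ih.2.2
      rw [hs]
      exact ⟨this.2.1, hu, this.1.trans Set.sdiff_subset⟩
  have hnext : ∀ n, Disjoint (s (n + 1)).2 (s (n + 1)).1 ∧ (s n).1 ⊆ closure (s (n + 1)).1 := by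
    intro n
    have := hN _ _ (mk_union_le_of_le hμ (hinv n).2.1 (hinv n).1) (hinv n).1 (hinv n).2.2
    rw [hs]
    exact ⟨Set.disjoint_left.2 fun x hx hx' => (this.1 hx').2 hx, this.2.2⟩
  have hacc : ∀ m n, m < n → (s m).1 ⊆ (s n).2 := by
    intro m n hmn
    induction n, hmn using Nat.le_induction with
    | base => rw [hs]; exact Set.subset_union_right
    | succ n _ ih => rw [hs]; exact ih.trans Set.subset_union_left
  have hdisj : ∀ m n, m < n → Disjoint (s m).1 (s n).1 := by
    intro m n hmn
    obtain ⟨k, rfl⟩ : ∃ k, n = k + 1 := ⟨n - 1, by omega⟩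
    exact (hnext k).1.mono_left (hacc m _ hmn)
  have hcl : ∀ m n, m ≤ n → (s m).1 ⊆ closure (s n).1 := by
    intro m n hmn
    induction n, hmn using Nat.le_induction with
    | base => exact subset_closure
    | succ n _ ih => exact ih.trans (closure_minimal (hnext n).2 isClosed_closure)
  refine ⟨fun i => ⋃ k, (s (Nat.pair i k)).1, fun i => Set.iUnion_subset fun k => (hinv _).2.2,
    ?_, ?_, ?_⟩
  · exact ⟨p, Set.mem_iUnion.2 ⟨0, rfl⟩⟩
  · intro i j hij
    refine Set.disjoint_iUnion_left.2 fun k => Set.disjoint_iUnion_right.2 fun l => ?_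
    have hne : Nat.pair i k ≠ Nat.pair j l := fun h => hij (Nat.pair_eq_pair.1 h).1
    rcases lt_or_gt_of_ne hne with h | h
    · exact hdisj _ _ h
    · exact (hdisj _ _ h).symm
  · intro i j
    refine Set.iUnion_subset fun k => (hcl _ _ (Nat.right_le_pair j (Nat.pair i k))).trans ?_
    exact closure_mono (Set.subset_iUnion (fun k => (s (Nat.pair j k)).1) _)

/-- Let `G` be the points satisfying the hypothesis of `containsResolvable_of_small_limits`. Each
point `q` of `C \ G` has a small obstruction `F q`. Closing a bad point under obstructions would
give a forbidden small `D`. -/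
theorem containsResolvable_of_no_selector {μ : Cardinal.{u}} (hμ : ℵ₀ ≤ μ) {V C : Set X}
    (hC : ClosedUnderSmall μ V C) (hne : C.Nonempty)
    (h : ∀ D ⊆ C, D.Nonempty → #D ≤ μ → ¬ ClosedUnderSmall μ V (C \ D)) :
    ContainsResolvable C := by
  refine containsResolvable_of_small_limits hμ hne ?_
  by_contra! hbad
  let G : Set X := {g ∈ C | ∀ F : Set X, #F ≤ μ → ∃ N ⊆ C \ F, #N ≤ μ ∧ g ∈ closure N}
  obtain ⟨p, hpC, F₀, hF₀, hpF₀⟩ := hbad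
  have hpG : p ∉ G := by
    intro hp
    obtain ⟨N, h1, h2, h3⟩ := hp.2 F₀ hF₀
    exact hpF₀ N h1 h2 h3
  have hGcl : ∀ N ⊆ G, #N ≤ μ → ∀ y ∈ C, y ∈ closure N → y ∈ G := by
    intro N hN hNμ y hyC hyN
    refine ⟨hyC, fun F hF => ?_⟩
    have : ∀ x, ∃ M : Set X, x ∈ N → M ⊆ C \ F ∧ #M ≤ μ ∧ x ∈ closure M := by
      intro x
      by_cases hx : x ∈ N
      · obtain ⟨M, hM⟩ := (hN hx).2 F hF
        exact ⟨M, fun _ => hM⟩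
      · exact ⟨∅, fun hx' => absurd hx' hx⟩
    choose M hM using this
    refine ⟨⋃ x ∈ N, M x, Set.iUnion₂_subset fun x hx => (hM x hx).1,
      mk_biUnion_le_of_le hμ hNμ fun x hx => (hM x hx).2.1, ?_⟩
    refine closure_minimal (fun x hx => ?_) isClosed_closure hyN
    exact closure_mono (Set.subset_biUnion_of_mem hx) (hM x hx).2.2
  have hF : ∀ q, ∃ F : Set X, #F ≤ μ ∧
      (q ∈ C \ G → ∀ N ⊆ C \ F, #N ≤ μ → q ∉ closure N) := by
    intro q
    by_cases hq : q ∈ C \ G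
    · by_contra! hcon
      refine hq.2 ⟨hq.1, fun F hF => ?_⟩
      obtain ⟨_, N, h1, h2, h3⟩ := hcon F hF
      exact ⟨N, h1, h2, h3⟩
    · exact ⟨∅, mk_empty_le μ, fun hq' => absurd hq' hq⟩
  choose F hFμ hF using hF
  let D : ℕ → Set X := fun n => Nat.rec {p} (fun _ D => (⋃ q ∈ D, F q) ∩ (C \ G)) n
  have hDs : ∀ n, D (n + 1) = (⋃ q ∈ D n, F q) ∩ (C \ G) := fun _ => rfl
  have hDμ : ∀ n, #(↥(D n)) ≤ μ := by
    intro n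
    induction n with
    | zero => exact mk_singleton_le_of_aleph0_le hμ p
    | succ n ih =>
      rw [hDs]
      exact (Cardinal.mk_le_mk_of_subset Set.inter_subset_left).trans
        (mk_biUnion_le_of_le hμ ih fun q _ => hFμ q)
  have hDC : ∀ n, D n ⊆ C \ G := by
    intro n
    cases n with
    | zero => exact Set.singleton_subset_iff.2 ⟨hpC, hpG⟩
    | succ n => rw [hDs]; exact Set.inter_subset_right
  refine h (⋃ n, D n) (Set.iUnion_subset fun n => (hDC n).trans Set.sdiff_subset)
    ⟨p, Set.mem_iUnion.2 ⟨0, rfl⟩⟩ (mk_iUnion_nat_le_of_le hμ hDμ)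
    ⟨Set.sdiff_subset.trans hC.1, fun N hN hNμ y hy => ?_⟩
  have hyC : y ∈ C := hC.2 N (hN.trans Set.sdiff_subset) hNμ hy
  refine ⟨hyC, fun hyD => ?_⟩
  obtain ⟨n, hn⟩ := Set.mem_iUnion.1 hyD
  have hyG := (hDC n) hn
  -- The part outside `F y` cannot reach `y` by choice of `F y`. The part inside avoids `D`, so it
  -- lies in `G`, which is closed in `C` under small limits.
  have hsplit : y ∈ closure (N \ F y) ∪ closure (N ∩ F y) := by
    rw [← closure_union, Set.sdiff_union_inter]
    exact hy.1
  rcases hsplit with h1 | h1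
  · refine hF y hyG (N \ F y) (fun x (hx : x ∈ N \ F y) => ⟨(hN hx.1).1, hx.2⟩) ?_ h1
    exact (Cardinal.mk_le_mk_of_subset Set.sdiff_subset).trans hNμ
  · refine hyG.2 (hGcl (N ∩ F y) (fun x hx => ?_) ?_ y hyC h1)
    · by_contra hxG
      refine (hN hx.1).2 (Set.mem_iUnion.2 ⟨n + 1, ?_⟩)
      rw [hDs]
      exact ⟨Set.mem_biUnion hn hx.2, (hN hx.1).1, hxG⟩
    · exact (Cardinal.mk_le_mk_of_subset Set.inter_subset_left).trans hNμ

theorem containsResolvable_or_exists_rank {μ : Cardinal.{u}} (hμ : ℵ₀ ≤ μ) (V : Set X) :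
    ContainsResolvable V ∨ ∃ e : X → Ordinal.{u}, (∀ α, #{x ∈ V | e x = α} ≤ μ) ∧
      ∀ q ∈ V, ∀ N ⊆ V, #N ≤ μ → (∀ x ∈ N, e q < e x) → q ∉ closure N := by
  by_cases h : ∀ C, ClosedUnderSmall μ V C → C.Nonempty →
      ∃ D ⊆ C, D.Nonempty ∧ #D ≤ μ ∧ ClosedUnderSmall μ V (C \ D)
  · exact Or.inr (exists_rank_of_selectors h)
  · push Not at h
    obtain ⟨C, hC, hne, hno⟩ := h
    exact Or.inl ((containsResolvable_of_no_selector hμ hC hne hno).mono hC.1)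

/-- Iterated sets of points of `V` that are limits of points of smaller rank. -/
def limitTower (e : X → Ordinal.{u}) (V : Set X) : ℕ → Set X
  | 0 => V
  | n + 1 => {q ∈ V | q ∈ closure {x ∈ limitTower e V n | e x < e q}}

theorem limitTower_antitone (e : X → Ordinal.{u}) (V : Set X) : Antitone (limitTower e V) := by
  refine antitone_nat_of_succ_le fun n => ?_
  induction n with
  | zero => exact fun q hq => hq.1
  | succ n ih =>
    exact fun q hq => ⟨hq.1, closure_mono
      (Set.ofPred_subset_ofPred.2 fun x hx => ⟨ih hx.1, hx.2⟩) hq.2⟩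

theorem limitTower_subset (e : X → Ordinal.{u}) (V : Set X) (n : ℕ) : limitTower e V n ⊆ V :=
  limitTower_antitone e V (Nat.zero_le n)

theorem containsResolvable_of_dense_limitTower {e : X → Ordinal.{u}} {V : Set X} (hV : IsOpen V)
    (hne : V.Nonempty) (h : ∀ n, V ⊆ closure (limitTower e V n)) : ContainsResolvable V := by
  have hd : ∀ n, V ⊆ closure (limitTower e V n \ limitTower e V (n + 1)) := by
    intro n q hq
    refine mem_closure_iff.2 fun W hW hqW => ?_
    have hne : ((W ∩ V) ∩ limitTower e V n).Nonempty :=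
      mem_closure_iff.1 (h n hq) _ (hW.inter hV) ⟨hqW, hq⟩
    let s := (W ∩ V) ∩ limitTower e V n
    -- A point of least rank in `s` is not a limit of lower-rank points of the tower, so it drops
    -- out at the next level.
    have hmin : ∃ x ∈ s, ∀ y ∈ s, ¬ e y < e x := by
      obtain ⟨x, hx, hm⟩ := (InvImage.wf e Ordinal.lt_wf).has_min s hne
      exact ⟨x, hx, hm⟩
    obtain ⟨x, hx, hm⟩ := hmin
    refine ⟨x, hx.1.1, hx.2, fun hx' => ?_⟩
    obtain ⟨y, hyW, hyT, hlt⟩ := mem_closure_iff.1 hx'.2 _ (hW.inter hV) hx.1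
    exact hm y ⟨hyW, hyT⟩ hlt
  refine ⟨fun n => limitTower e V n \ limitTower e V (n + 1),
    fun n => Set.sdiff_subset.trans (limitTower_subset e V n), ?_, ?_, ?_⟩
  · obtain ⟨q, hq⟩ := hne
    exact closure_nonempty_iff.1 ⟨q, hd 0 hq⟩
  · have key : ∀ i j, i < j → Disjoint (limitTower e V i \ limitTower e V (i + 1))
        (limitTower e V j \ limitTower e V (j + 1)) := fun i j hij =>
      Set.disjoint_left.2 fun x hx hx' => hx.2 (limitTower_antitone e V hij hx'.1)
    intro i j hij
    rcases lt_or_gt_of_ne hij with h | h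
    · exact key i j h
    · exact (key j i h).symm
  · exact fun i j => (Set.sdiff_subset.trans (limitTower_subset e V i)).trans (hd j)

end Pieces

/-! ### Sets meeting countably many ranks. -/

section CountableImage

variable {X : Type u}

theorem mk_le_of_countable_image {Z : Type*} {μ : Cardinal.{u}} (hμ : ℵ₀ ≤ μ) {V : Set X}
    {e : X → Z} (he : ∀ α, #{x ∈ V | e x = α} ≤ μ) {A B : Set X} (hBV : B ⊆ V)
    (hA : A.Countable) (hAB : e '' A = e '' B) : #B ≤ μ := by
  have h : B ⊆ ⋃ a ∈ A, {x ∈ V | e x = e a} := by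
    intro b hb
    obtain ⟨a, ha, hab⟩ := hAB ▸ Set.mem_image_of_mem e hb
    exact Set.mem_biUnion ha ⟨hBV hb, hab.symm⟩
  exact (Cardinal.mk_le_mk_of_subset h).trans
    (mk_biUnion_le_of_le hμ (((Cardinal.le_aleph0_iff_set_countable).2 hA).trans hμ)
      fun a _ => he _)

end CountableImage

/-! ### Extracting an uncountable rank-injective set. -/

section Spread

variable {X : Type u} [TopologicalSpace X]

theorem exists_isOpen_mem_closure_subset [RegularSpace X] {V : Set X} (hV : IsOpen V) {q : X}
    (hq : q ∈ V) : ∃ W, IsOpen W ∧ q ∈ W ∧ closure W ⊆ V := by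
  obtain ⟨t, ht, htc, htV⟩ := exists_mem_nhds_isClosed_subset (hV.mem_nhds hq)
  exact ⟨interior t, isOpen_interior, mem_interior_iff_mem_nhds.2 ht,
    (closure_minimal interior_subset htc).trans htV⟩

/-- If no such `A` existed, deleting from `V'` the points of `K` with ranks in any prescribed set
would leave an open set. This forces `K = V'` and makes single rank fibres open in `V'`, although
they are too small. -/
theorem exists_uncountable_rank_discrete [RegularSpace X] (hgen : IsCountableExtentGenerated X)
    {μ : Cardinal.{u}} (hμ : ℵ₀ ≤ μ) {V V' : Set X} {e : X → Ordinal.{u}}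
    (he : ∀ α, #{x ∈ V | e x = α} ≤ μ)
    (hl : ∀ q ∈ V, ∀ N ⊆ V, #N ≤ μ → (∀ x ∈ N, e q < e x) → q ∉ closure N)
    (hbig : ∀ U ⊆ V, IsOpen U → U.Nonempty → μ < #U) {n : ℕ}
    (hn : V ⊆ closure (limitTower e V n)) (hV' : IsOpen V') (hV'V : V' ⊆ V) (hne : V'.Nonempty)
    (hdisj : Disjoint V' (limitTower e V (n + 1))) :
    ∃ Y A : Set X, HasCountableExtent Y ∧ A ⊆ Y ∧ ¬ A.Countable ∧ Set.InjOn e A ∧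
      closure A ⊆ V' ∧ ∀ q ∈ V', ∀ B ⊆ A, #B ≤ μ → q ∉ closure {b ∈ B | e b ≠ e q} := by
  set S := limitTower e V n ∩ V' with hSdef
  have hSV : S ⊆ V := Set.inter_subset_right.trans hV'V
  have hS : V' ⊆ closure S := by
    intro q hq
    refine mem_closure_iff.2 fun W hW hqW => ?_
    obtain ⟨x, hx, hxT⟩ := mem_closure_iff.1 (hn (hV'V hq)) _ (hW.inter hV') ⟨hqW, hq⟩
    exact ⟨x, hx.1, hxT, hx.2⟩
  have hsub : ∀ {N N' : Set X}, N' ⊆ N → #N ≤ μ → #N' ≤ μ := fun h h' =>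
    (Cardinal.mk_le_mk_of_subset h).trans h'
  have hSmall : ∀ q ∈ V', ∀ N ⊆ S, #N ≤ μ → q ∉ closure {x ∈ N | e x ≠ e q} := by
    intro q hq N hN hNμ hcl
    have : {x ∈ N | e x ≠ e q} = {x ∈ N | e x < e q} ∪ {x ∈ N | e q < e x} := by
      ext x
      simp only [Set.mem_ofPred_eq, Set.mem_union, ne_eq]
      rw [← and_or_left]
      exact and_congr_right fun _ => lt_or_lt_iff_ne.symm
    rw [this, closure_union] at hcl
    rcases hcl with h | h
    · refine Set.disjoint_left.1 hdisj hq ⟨hV'V hq, closure_mono ?_ h⟩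
      exact fun x hx => ⟨(hN hx.1).1, hx.2⟩
    · exact hl q (hV'V hq) {x ∈ N | e q < e x} (fun x hx => hSV (hN hx.1))
        (hsub (fun x hx => hx.1) hNμ) (fun x hx => hx.2) h
  -- Passing from `S` to its small equal-rank limits keeps the separation of ranks and makes the set
  -- closed in `V'` under small limits.
  set K := {q ∈ V' | ∃ N ⊆ S, #N ≤ μ ∧ (∀ x ∈ N, e x = e q) ∧ q ∈ closure N} with hK
  have hw : ∀ q, ∃ N : Set X, q ∈ K → N ⊆ S ∧ #N ≤ μ ∧ (∀ x ∈ N, e x = e q) ∧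
      q ∈ closure N := by
    intro q
    by_cases hq : q ∈ K
    · obtain ⟨N, hN⟩ := hq.2
      exact ⟨N, fun _ => hN⟩
    · exact ⟨∅, fun h => absurd h hq⟩
  choose M hM using hw
  have hMcl : ∀ B ⊆ K, closure B ⊆ closure (⋃ b ∈ B, M b) := fun B hB =>
    closure_minimal (fun b hb => closure_mono (Set.subset_biUnion_of_mem hb)
      (hM b (hB hb)).2.2.2) isClosed_closure
  have hMS : ∀ B ⊆ K, (⋃ b ∈ B, M b) ⊆ S := fun B hB =>
    Set.iUnion₂_subset fun b hb => (hM b (hB hb)).1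
  have hMμ : ∀ B ⊆ K, #B ≤ μ → #(⋃ b ∈ B, M b : Set X) ≤ μ := fun B hB hBμ =>
    mk_biUnion_le_of_le hμ hBμ fun b hb => (hM b (hB hb)).2.1
  have hKne : ∀ q ∈ V', ∀ B ⊆ K, #B ≤ μ → q ∉ closure {b ∈ B | e b ≠ e q} := by
    intro q hq B hB hBμ hcl
    have hB' : {b ∈ B | e b ≠ e q} ⊆ K := fun b hb => hB hb.1
    refine hSmall q hq _ (hMS _ hB') (hMμ _ hB' (hsub (fun b hb => hb.1) hBμ))
      (closure_mono ?_ (hMcl _ hB' hcl))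
    intro x hx
    refine ⟨hx, ?_⟩
    obtain ⟨b, hb, hxb⟩ := Set.mem_iUnion₂.1 hx
    rw [(hM b (hB' hb)).2.2.1 x hxb]
    exact hb.2
  have hKeq : ∀ q ∈ V', ∀ B ⊆ K, #B ≤ μ → q ∈ closure B →
      q ∈ K ∧ ∃ b ∈ B, e b = e q := by
    intro q hq B hB hBμ hcl
    have : B = {b ∈ B | e b ≠ e q} ∪ {b ∈ B | e b = e q} := by
      ext b
      simp only [Set.mem_ofPred_eq, Set.mem_union, ne_eq]
      tauto
    rw [this, closure_union] at hcl
    have hcl' := hcl.resolve_left (hKne q hq B hB hBμ)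
    have hB' : {b ∈ B | e b = e q} ⊆ K := fun b hb => hB hb.1
    refine ⟨⟨hq, _, hMS _ hB', hMμ _ hB' (hsub (fun b hb => hb.1) hBμ), ?_, hMcl _ hB' hcl'⟩, ?_⟩
    · intro x hx
      obtain ⟨b, hb, hxb⟩ := Set.mem_iUnion₂.1 hx
      rw [(hM b (hB' hb)).2.2.1 x hxb]
      exact hb.2
    · exact closure_nonempty_iff.1 ⟨q, hcl'⟩
  by_contra hfail
  have hcount : ∀ Y A : Set X, HasCountableExtent Y → A ⊆ Y → A ⊆ K → Set.InjOn e A →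
      closure A ⊆ V' → A.Countable := by
    intro Y A hY hAY hAK hinj hcl
    by_contra hA
    exact hfail ⟨Y, A, hY, hAY, hA, hinj, hcl, fun q hq B hB => hKne q hq B (hB.trans hAK)⟩
  have hopen : ∀ P : Set Ordinal.{u}, IsOpen (V' \ {q ∈ K | e q ∈ P}) := by
    intro P
    refine IsCoherentWith.isOpen_of_forall_induced hgen _ fun Y hY => ?_
    rw [isOpen_iff_mem_nhds]
    rintro ⟨q, hqY⟩ ⟨hqV', hqK⟩
    obtain ⟨W, hW, hqW, hWV'⟩ := exists_isOpen_mem_closure_subset hV' hqV'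
    set B := (Y ∩ {q ∈ K | e q ∈ P}) ∩ W with hB
    have hBK : B ⊆ K := fun x hx => hx.1.2.1
    have hBμ : #B ≤ μ := by
      -- A transversal of the rank fibres of `B` is countable by `hcount`, and the fibres are small,
      -- so `B` is small.
      obtain ⟨A, hAB, hA⟩ := Set.exists_subset_bijOn B e
      refine mk_le_of_countable_image hμ he (fun x hx => hV'V (hBK hx).1) (A := A) ?_ hA.image_eq
      refine hcount Y A hY (fun x hx => (hAB hx).1.1) (hAB.trans hBK) hA.injOn ?_
      exact (closure_mono fun x hx => (hAB hx).2).trans hWV'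
    have hqB : q ∉ closure B := by
      intro hcl
      obtain ⟨hqK', b, hb, hbq⟩ := hKeq q hqV' B hBK hBμ hcl
      exact hqK ⟨hqK', hbq ▸ hb.1.2.2⟩
    refine mem_of_superset ((continuous_subtype_val.isOpen_preimage _
      (hW.inter isClosed_closure.isOpen_compl)).mem_nhds ⟨hqW, hqB⟩) ?_
    rintro ⟨x, hxY⟩ ⟨hxW, hxB⟩
    exact ⟨hWV' (subset_closure hxW), fun hx => hxB (subset_closure ⟨⟨hxY, hx⟩, hxW⟩)⟩
  have hSK : S ⊆ K := fun x hx => ⟨hx.2, {x}, Set.singleton_subset_iff.2 hx,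
    mk_singleton_le_of_aleph0_le hμ x, fun y hy => by rw [hy], subset_closure rfl⟩
  have hV'K : V' ⊆ K := by
    intro q hq
    by_contra hqK
    obtain ⟨x, hx, hxS⟩ := mem_closure_iff.1 (hS hq) _ (hopen Set.univ) ⟨hq, fun h => hqK h.1⟩
    exact hx.2 ⟨hSK hxS, trivial⟩
  obtain ⟨q, hq⟩ := hne
  have hlt := hbig _ (Set.sdiff_subset.trans hV'V) (hopen {β | β ≠ e q}) ⟨q, hq, fun h => h.2 rfl⟩
  refine absurd (hlt.trans_le ((Cardinal.mk_le_mk_of_subset ?_).trans (he (e q)))) (lt_irrefl _)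
  intro x hx
  exact ⟨hV'V hx.1, by_contra fun h => hx.2 ⟨hV'K hx.1, h⟩⟩

end Spread

/-! ### Almost disjoint families and disjoint refinement. -/

section Combinatorics

theorem countable_iff_mk_lt_aleph_one {X : Type u} {A : Set X} : A.Countable ↔ #A < ℵ₁ := by
  rw [← Cardinal.succ_aleph0, Order.lt_succ_iff, Cardinal.le_aleph0_iff_set_countable]

theorem exists_injective_mem_of_mk_lt {ι Z : Type u} {κ : Cardinal.{u}} (hι : #ι ≤ κ)
    (S : ι → Set Z) (hS : ∀ i, κ < #(S i)) :
    ∃ f : ι → Z, Function.Injective f ∧ ∀ i, f i ∈ S i := by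
  have hex : ∀ (i : ι) (R : Set Z), ∃ z, #R ≤ κ → z ∈ S i \ R := by
    intro i R
    by_cases hR : #R ≤ κ
    · have : ¬ S i ⊆ R := fun h => ((Cardinal.mk_le_mk_of_subset h).trans hR).not_gt (hS i)
      obtain ⟨z, hz⟩ := Set.not_subset.1 this
      exact ⟨z, fun _ => hz⟩
    · have : (S i).Nonempty := by
        rw [← Set.nonempty_coe_sort, ← Cardinal.mk_ne_zero_iff]
        exact ne_bot_of_gt (hS i)
      exact ⟨this.some, fun h => absurd h hR⟩
  choose c hc using hex
  have wf : WellFounded (WellOrderingRel : ι → ι → Prop) := WellOrderingRel.isWellOrder.wf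
  let f : ι → Z := wf.fix fun i ih => c i (Set.range fun j : {j // WellOrderingRel j i} => ih j.1 j.2)
  have hf : ∀ i, f i ∈ S i \ Set.range fun j : {j // WellOrderingRel j i} => f j.1 := by
    intro i
    have h1 : f i = c i (Set.range fun j : {j // WellOrderingRel j i} => f j.1) := wf.fix_eq _ i
    exact h1.symm ▸ hc i _ (Cardinal.mk_range_le.trans ((Cardinal.mk_subtype_le _).trans hι))
  refine ⟨f, fun i j hij => ?_, fun i => (hf i).1⟩
  rcases trichotomous_of (WellOrderingRel (α := ι)) i j with h | h | h
  · exact absurd ⟨⟨i, h⟩, hij⟩ (hf j).2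
  · exact h
  · exact absurd ⟨⟨j, h⟩, hij.symm⟩ (hf i).2

theorem exists_mem_mk_lt_of_forall_exists {Ω X : Type u} {κ : Cardinal.{u}} (hκ : ℵ₀ ≤ κ)
    {Ξ : Set Ω} {Q : Set X} {R : Ω → X → Prop} (hQ : #Q ≤ κ) (hΞ : κ < #Ξ)
    (h : ∀ ξ ∈ Ξ, ∃ q ∈ Q, R ξ q) : ∃ q ∈ Q, κ < #{ξ ∈ Ξ | R ξ q} := by
  by_contra! hle
  have hsub : Ξ ⊆ ⋃ q ∈ Q, {ξ ∈ Ξ | R ξ q} := by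
    intro ξ hξ
    obtain ⟨q, hq, hR⟩ := h ξ hξ
    exact Set.mem_biUnion hq ⟨hξ, hR⟩
  exact ((Cardinal.mk_le_mk_of_subset hsub).trans (mk_biUnion_le_of_le hκ hQ hle)).not_gt hΞ

theorem exists_injective_countable_initial {ι : Type u} (h : #ι ≤ ℵ₁) :
    ∃ g : ι → (ℵ₁ : Cardinal.{u}).ord.ToType, Function.Injective g ∧
      ∀ i, {j | g j < g i}.Countable := by
  have h' : #ι ≤ #((ℵ₁ : Cardinal.{u}).ord.ToType) := by rwa [Cardinal.mk_ord_toType]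
  obtain ⟨g⟩ := h'
  refine ⟨g, g.injective, fun i => ?_⟩
  have : (Set.Iio (g i)).Countable :=
    countable_iff_mk_lt_aleph_one.2
      ((Cardinal.mk_Iio_lt (g i) (by simp)).trans_eq (Cardinal.mk_ord_toType _))
  exact this.preimage g.injective

theorem sdiff_iUnion_initial_not_countable {ι L : Type*} {X : Type u} [LT L] {g : ι → L}
    (hg : ∀ i, {j | g j < g i}.Countable) {A : ι → Set X} {i : ι}
    (hA : ∀ j, g j < g i → (A i ∩ A j).Countable) {B : Set X} (hB : B ⊆ A i)
    (hBc : ¬ B.Countable) : ¬ (B \ ⋃ j ∈ {j | g j < g i}, A j).Countable := by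
  intro hc
  refine hBc ((hc.union ((hg i).biUnion (t := fun j _ => A i ∩ A j) hA)).mono fun x hx => ?_)
  by_cases h : x ∈ ⋃ j ∈ {j | g j < g i}, A j
  · obtain ⟨j, hj, hxj⟩ := Set.mem_iUnion₂.1 h
    exact Or.inr (Set.mem_biUnion hj ⟨hB hx, hxj⟩)
  · exact Or.inl ⟨hx, h⟩

theorem aleph_one_le_mk_of_not_countable {X : Type u} {A : Set X} (hA : ¬ A.Countable) :
    ℵ₁ ≤ #A := not_lt.1 fun h => hA ((countable_iff_mk_lt_aleph_one).2 h)

theorem exists_aleph_one_disjoint_uncountable {X : Type u} {A : Set X} (hA : ¬ A.Countable) :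
    ∃ P : (ℵ₁ : Cardinal.{u}).ord.ToType → Set X, (∀ l, P l ⊆ A) ∧ (∀ l, ¬ (P l).Countable) ∧
      Pairwise (Function.onFun Disjoint P) := by
  have hL : #((ℵ₁ : Cardinal.{u}).ord.ToType) = ℵ₁ := Cardinal.mk_ord_toType _
  have h : #((ℵ₁ : Cardinal.{u}).ord.ToType × (ℵ₁ : Cardinal.{u}).ord.ToType) ≤ #A := by
    rw [← Cardinal.mul_def, hL, Cardinal.mul_eq_self (Cardinal.aleph0_le_aleph 1)]
    exact aleph_one_le_mk_of_not_countable hA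
  obtain ⟨φ⟩ := h
  refine ⟨fun l => Set.range fun m => (φ (l, m) : X), ?_, ?_, ?_⟩
  · rintro l _ ⟨m, rfl⟩
    exact (φ (l, m)).2
  · intro l hc
    have hinj : Function.Injective fun m => (φ (l, m) : X) := fun m m' h =>
      (Prod.ext_iff.1 (φ.injective (Subtype.ext h))).2
    have := (countable_iff_mk_lt_aleph_one).1 hc
    rw [Cardinal.mk_range_eq _ hinj, hL] at this
    exact lt_irrefl _ this
  · intro l l' hne
    refine Set.disjoint_left.2 ?_
    rintro _ ⟨m, rfl⟩ ⟨m', h⟩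
    exact hne (Prod.ext_iff.1 (φ.injective (Subtype.ext h))).1.symm

/-- A maximal almost disjoint family containing `ℵ₁` disjoint sets has more than `ℵ₁` members: with
only `ℵ₁`, picking from each member a point outside its countably many predecessors yields a new
uncountable set almost disjoint from all of them. -/
theorem exists_almostDisjoint_family {X Ω : Type u} (hΩ : #Ω ≤ Order.succ ℵ₁) {A : Set X}
    (hA : ¬ A.Countable) : ∃ g : Ω → Set X, (∀ ξ, g ξ ⊆ A) ∧ (∀ ξ, ¬ (g ξ).Countable) ∧
      Pairwise fun ξ η => (g ξ ∩ g η).Countable := by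
  obtain ⟨P, hPA, hPc, hPd⟩ := exists_aleph_one_disjoint_uncountable hA
  let 𝒮 : Set (Set (Set X)) := {𝒜 | (∀ s ∈ 𝒜, s ⊆ A ∧ ¬ s.Countable) ∧
    𝒜.Pairwise fun s t => (s ∩ t).Countable}
  have hP𝒮 : Set.range P ∈ 𝒮 := by
    refine ⟨?_, ?_⟩
    · rintro _ ⟨l, rfl⟩
      exact ⟨hPA l, hPc l⟩
    · rintro _ ⟨l, rfl⟩ _ ⟨l', rfl⟩ hne
      have := hPd (fun h : l = l' => hne (h ▸ rfl))
      rw [Set.disjoint_iff_inter_eq_empty.1 this]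
      exact Set.countable_empty
  obtain ⟨𝒜, hP𝒜, hmax⟩ := zorn_subset_nonempty 𝒮 (fun c hc hchain _ =>
    ⟨⋃₀ c, ⟨fun s ⟨t, ht, hs⟩ => (hc ht).1 s hs,
      (Set.pairwise_sUnion hchain.directedOn).2 fun t ht => (hc ht).2⟩,
      fun s hs => Set.subset_sUnion_of_mem hs⟩) _ hP𝒮
  have h𝒜 := hmax.prop
  have hge : ℵ₁ ≤ #𝒜 := by
    have hinj : Function.Injective P := by
      intro l l' h
      by_contra hne
      have := hPd hne
      rw [Function.onFun, h, disjoint_self] at this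
      exact hPc l' (this ▸ Set.countable_empty)
    calc ℵ₁ = #(Set.range P) := by rw [Cardinal.mk_range_eq _ hinj, Cardinal.mk_ord_toType]
      _ ≤ #𝒜 := Cardinal.mk_le_mk_of_subset hP𝒜
  have hgt : ℵ₁ < #𝒜 := by
    by_contra! hle
    obtain ⟨g, hg, hgc⟩ := exists_injective_countable_initial hle
    have hx : ∀ S : 𝒜, ∃ x, x ∈ S.1 \ ⋃ S' ∈ {S' | g S' < g S}, S'.1 := by
      intro S
      have := sdiff_iUnion_initial_not_countable hgc (A := fun S : 𝒜 => S.1) (i := S)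
        (fun S' hS' => h𝒜.2 S.2 S'.2 fun h => hS'.ne (congrArg g (Subtype.ext h.symm)))
        subset_rfl (h𝒜.1 S.1 S.2).2
      by_contra! hno
      exact this ((Set.eq_empty_of_forall_notMem hno).symm ▸ Set.countable_empty)
    choose x hx using hx
    have hxlt : ∀ S S', g S' < g S → x S ∉ S'.1 := fun S S' h hxS =>
      (hx S).2 (Set.mem_biUnion (show S' ∈ {S' | g S' < g S} from h) hxS)
    have hinj : Function.Injective x := by
      intro S S' h
      rcases lt_trichotomy (g S) (g S') with h1 | h1 | h1
      · exact absurd (h ▸ (hx S).1) (hxlt S' S h1)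
      · exact hg h1
      · exact absurd (h ▸ (hx S').1) (hxlt S S' h1)
    have hBc : ¬ (Set.range x).Countable := by
      intro hc
      have := (countable_iff_mk_lt_aleph_one).1 hc
      rw [Cardinal.mk_range_eq _ hinj] at this
      exact hge.not_gt this
    have hBS : ∀ S ∈ 𝒜, (Set.range x ∩ S).Countable := by
      intro S hS
      refine (((hgc ⟨S, hS⟩).image x).insert (x ⟨S, hS⟩)).mono ?_
      rintro _ ⟨⟨S', rfl⟩, hS'⟩
      rcases lt_trichotomy (g S') (g ⟨S, hS⟩) with h1 | h1 | h1
      · exact Or.inr ⟨S', h1, rfl⟩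
      · exact Or.inl (congrArg x (hg h1))
      · exact absurd hS' (hxlt S' ⟨S, hS⟩ h1)
    have hins : insert (Set.range x) 𝒜 ∈ 𝒮 := by
      refine ⟨?_, ?_⟩
      · rintro s (rfl | hs)
        · refine ⟨?_, hBc⟩
          rintro _ ⟨S, rfl⟩
          exact (h𝒜.1 S.1 S.2).1 (hx S).1
        · exact h𝒜.1 s hs
      · refine h𝒜.2.insert fun S hS _ => ⟨hBS S hS, ?_⟩
        rw [Set.inter_comm]
        exact hBS S hS
    have hB := hmax.le_of_ge hins (Set.subset_insert _ _) (Set.mem_insert _ _)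
    exact hBc (by simpa using hBS _ hB)
  have : #Ω ≤ #𝒜 := hΩ.trans (Order.succ_le_of_lt hgt)
  obtain ⟨φ⟩ := this
  exact ⟨fun ξ => (φ ξ).1, fun ξ => (h𝒜.1 _ (φ ξ).2).1, fun ξ => (h𝒜.1 _ (φ ξ).2).2,
    fun ξ η hne => h𝒜.2 (φ ξ).2 (φ η).2 fun h => hne (φ.injective (Subtype.ext h))⟩

end Combinatorics

/-! ### Condensing fans on open sets of size at most `ℵ₁`. -/

section Condensation

variable {X : Type u} [TopologicalSpace X]

/-- Every neighbourhood of `q` contains uncountably many points of `B`. -/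
def IsCondensationPoint (q : X) (B : Set X) : Prop :=
  ∀ W, IsOpen W → q ∈ W → ¬ (W ∩ B).Countable

/-- An `Ω`-indexed fan of almost disjoint uncountable subsets of an open set `carrier`, all of
which condense at the point `vertex`. -/
structure CondensingFan (Ω X : Type u) where
  carrier : Set X
  vertex : X
  blade : Ω → Set X

namespace CondensingFan

variable {Ω : Type u}

/-- The laws of a fan lying in `V`. -/
structure IsIn (t : CondensingFan Ω X) (V : Set X) : Prop where
  isOpen : IsOpen t.carrier
  carrier_subset : t.carrier ⊆ V
  vertex_mem : t.vertex ∈ t.carrier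
  blade_subset : ∀ ξ, t.blade ξ ⊆ t.carrier
  exists_condensation : ∀ ξ, ∀ B ⊆ t.blade ξ, ¬ B.Countable → ∃ q ∈ V, IsCondensationPoint q B
  almostDisjoint : Pairwise fun ξ η => (t.blade ξ ∩ t.blade η).Countable
  condensation : ∀ ξ, IsCondensationPoint t.vertex (t.blade ξ)

/-- At most `ℵ₁` blades of `s` have an uncountable trace on the carrier of `t`. -/
def Avoids (s t : CondensingFan Ω X) : Prop :=
  #{ξ | ¬ (s.blade ξ ∩ t.carrier).Countable} ≤ ℵ₁

/-- Fans with different vertices, one of which avoids the other. -/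
def Compatible (s t : CondensingFan Ω X) : Prop :=
  s.vertex ≠ t.vertex ∧ (s.Avoids t ∨ t.Avoids s)

/-- The points at which more than `ℵ₁` blades of some fan of the family condense. -/
def condensationSet (𝔉 : Set (CondensingFan Ω X)) (V : Set X) : Set X :=
  {q ∈ V | ∃ t ∈ 𝔉, ℵ₁ < #{ξ | IsCondensationPoint q (t.blade ξ)}}

theorem mk_family_le {𝔉 : Set (CondensingFan Ω X)} {V : Set X} (hV : #V ≤ ℵ₁)
    (h𝔉 : ∀ t ∈ 𝔉, t.IsIn V) (hc : 𝔉.Pairwise Compatible) : #𝔉 ≤ ℵ₁ := by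
  refine le_trans (Cardinal.mk_le_of_injective (f := fun t : 𝔉 => (⟨t.1.vertex,
    (h𝔉 t.1 t.2).carrier_subset (h𝔉 t.1 t.2).vertex_mem⟩ : V)) fun s t hst => ?_) hV
  by_contra hne
  exact (hc s.2 t.2 fun h => hne (Subtype.ext h)).1 (congrArg Subtype.val hst)

theorem exists_maximal_family (Ω : Type u) (V : Set X) :
    ∃ 𝔉 : Set (CondensingFan Ω X), (∀ t ∈ 𝔉, t.IsIn V) ∧ 𝔉.Pairwise Compatible ∧
      ∀ t, t.IsIn V → (∀ s ∈ 𝔉, s.Compatible t) → t ∈ 𝔉 := by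
  obtain ⟨𝔉, hmax⟩ := zorn_subset
    {𝔉 : Set (CondensingFan Ω X) | (∀ t ∈ 𝔉, t.IsIn V) ∧ 𝔉.Pairwise Compatible}
    (fun c hc hchain => ⟨⋃₀ c, ⟨fun s ⟨t, ht, hs⟩ => (hc ht).1 s hs,
      (Set.pairwise_sUnion hchain.directedOn).2 fun t ht => (hc ht).2⟩,
      fun s hs => Set.subset_sUnion_of_mem hs⟩)
  refine ⟨𝔉, hmax.prop.1, hmax.prop.2, fun t ht hts => ?_⟩
  refine hmax.le_of_ge (y := insert t 𝔉) ⟨?_, ?_⟩ (Set.subset_insert _ _) (Set.mem_insert _ _)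
  · rintro s (rfl | hs)
    · exact ht
    · exact hmax.prop.1 s hs
  · exact hmax.prop.2.insert fun s hs _ => ⟨⟨(hts s hs).1.symm, (hts s hs).2.symm⟩, hts s hs⟩

/-- If the condensation set missed an open `W`, with closure still off it, then by pigeonhole each
fan of `𝔉` would have at most `ℵ₁` blades with uncountable trace on `W`. A new fan built in `W`
would be compatible with `𝔉`, hence in it, and its vertex would be a condensation point of too many
blades. -/
theorem subset_closure_condensationSet [RegularSpace X] (hΩ : #Ω = Order.succ ℵ₁) {V : Set X}
    (hV : IsOpen V) (hVcard : #V ≤ ℵ₁)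
    (hA : ∀ W ⊆ V, IsOpen W → W.Nonempty → ∃ A ⊆ W, ¬ A.Countable ∧
      ∀ B ⊆ A, ¬ B.Countable → ∃ q ∈ W, IsCondensationPoint q B)
    {𝔉 : Set (CondensingFan Ω X)} (h𝔉 : ∀ t ∈ 𝔉, t.IsIn V)
    (hmax : ∀ t, t.IsIn V → (∀ s ∈ 𝔉, s.Compatible t) → t ∈ 𝔉) :
    V ⊆ closure (condensationSet 𝔉 V) := by
  have hω : ℵ₀ ≤ (ℵ₁ : Cardinal.{u}) := Cardinal.aleph0_le_aleph 1
  have hΩlt : ℵ₁ < #Ω := hΩ ▸ Order.lt_succ _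
  intro q₀ hq₀
  by_contra hq₀T
  set O := V \ closure (condensationSet 𝔉 V) with hO
  have hOT : ∀ q ∈ O, q ∉ condensationSet 𝔉 V := fun q hq h => hq.2 (subset_closure h)
  obtain ⟨W, hW, hqW, hWO⟩ :=
    exists_isOpen_mem_closure_subset (hV.sdiff isClosed_closure) (show q₀ ∈ O from ⟨hq₀, hq₀T⟩)
  have hWO' : W ⊆ O := subset_closure.trans hWO
  have hWV : W ⊆ V := hWO'.trans Set.sdiff_subset
  have hWcard : #W ≤ ℵ₁ := (Cardinal.mk_le_mk_of_subset hWV).trans hVcard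
  have hfew : ∀ t ∈ 𝔉, #{ξ | ¬ (t.blade ξ ∩ W).Countable} ≤ ℵ₁ := by
    intro t ht
    by_contra! hlt
    have hOcard : #O ≤ ℵ₁ := (Cardinal.mk_le_mk_of_subset Set.sdiff_subset).trans hVcard
    obtain ⟨q, hqO, hq⟩ := exists_mem_mk_lt_of_forall_exists hω
      (R := fun ξ q => IsCondensationPoint q (t.blade ξ)) hOcard hlt (by
        intro ξ hξ
        obtain ⟨q, hqV, hq⟩ := (h𝔉 t ht).exists_condensation ξ _ Set.inter_subset_left hξ
        refine ⟨q, hWO (mem_closure_iff.2 fun G hG hqG => ?_), fun G hG hqG hc => ?_⟩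
        · by_contra hne
          refine hq G hG hqG (Set.countable_empty.mono fun x hx => hne ⟨x, hx.1, hx.2.2⟩)
        · exact hq G hG hqG (hc.mono (Set.inter_subset_inter_right _ Set.inter_subset_left)))
    refine hOT q hqO ⟨hqO.1, t, ht, hq.trans_le (Cardinal.mk_le_mk_of_subset ?_)⟩
    exact fun ξ hξ => hξ.2
  obtain ⟨A, hAW, hAc, hAq⟩ := hA W hWV hW ⟨q₀, hqW⟩
  obtain ⟨g, hgA, hgc, hgd⟩ := exists_almostDisjoint_family hΩ.le hAc
  obtain ⟨p, hpW, hp⟩ := exists_mem_mk_lt_of_forall_exists hω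
    (Ξ := (Set.univ : Set Ω)) (R := fun ξ q => IsCondensationPoint q (g ξ)) hWcard
    (by rwa [Cardinal.mk_univ]) (fun ξ _ => hAq (g ξ) (hgA ξ) (hgc ξ))
  obtain ⟨φ⟩ : #Ω ≤ #{ξ ∈ (Set.univ : Set Ω) | IsCondensationPoint p (g ξ)} :=
    hΩ.le.trans (Order.succ_le_of_lt hp)
  have hvertex : ∀ s ∈ 𝔉, s.vertex ∈ condensationSet 𝔉 V := fun s hs =>
    ⟨(h𝔉 s hs).carrier_subset (h𝔉 s hs).vertex_mem, s, hs, by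
      have : {ξ | IsCondensationPoint s.vertex (s.blade ξ)} = Set.univ :=
        Set.eq_univ_of_forall (h𝔉 s hs).condensation
      rwa [this, Cardinal.mk_univ]⟩
  have hpT := hvertex _ (hmax ⟨W, p, fun η => g (φ η)⟩
    { isOpen := hW
      carrier_subset := hWV
      vertex_mem := hpW
      blade_subset := fun ξ => (hgA _).trans hAW
      exists_condensation := fun ξ B hB hBc => by
        obtain ⟨q, hq, hqB⟩ := hAq B (hB.trans (hgA _)) hBc
        exact ⟨q, hWV hq, hqB⟩
      almostDisjoint := fun ξ η hne =>
        hgd fun h => hne (φ.injective (Subtype.ext h))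
      condensation := fun ξ => (φ ξ).2.2 }
    fun s hs => ⟨fun h => hOT p (hWO' hpW) (by
      have hs' := hvertex s hs
      rw [h] at hs'
      exact hs'), Or.inl (hfew s hs)⟩)
  exact hOT p (hWO' hpW) hpT

/-- Give each pair of a point of `T` and a natural number its own blade condensing at that point, so
that the chosen blades are almost disjoint. Subtracting predecessors makes them disjoint without
losing the point from the closure. -/
theorem containsResolvable_of_condensationSet {V : Set X} (hV : V.Nonempty) (hVcard : #V ≤ ℵ₁)
    {𝔉 : Set (CondensingFan Ω X)} (h𝔉 : ∀ t ∈ 𝔉, t.IsIn V) (hc : 𝔉.Pairwise Compatible)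
    (hd : V ⊆ closure (condensationSet 𝔉 V)) : ContainsResolvable V := by
  have hω : ℵ₀ ≤ (ℵ₁ : Cardinal.{u}) := Cardinal.aleph0_le_aleph 1
  set T := condensationSet 𝔉 V with hT
  have hTfan : ∀ q : T, ∃ t ∈ 𝔉, ℵ₁ < #{ξ | IsCondensationPoint q.1 (t.blade ξ)} :=
    fun q => q.2.2
  choose t ht𝔉 ht using hTfan
  -- The blades of `t` to be discarded: those with uncountable trace on the carrier of a fan that
  -- `t` avoids. There are at most `ℵ₁`.
  let Ex : CondensingFan Ω X → Set Ω := fun t =>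
    ⋃ s ∈ {s ∈ 𝔉 | t.Avoids s}, {ξ | ¬ (t.blade ξ ∩ s.carrier).Countable}
  have hEx : ∀ t, #(Ex t) ≤ ℵ₁ := fun t => mk_biUnion_le_of_le hω
    ((Cardinal.mk_le_mk_of_subset fun s hs => hs.1).trans (mk_family_le hVcard h𝔉 hc))
    fun s hs => hs.2
  have hTV : #T ≤ ℵ₁ := (Cardinal.mk_le_mk_of_subset fun q hq => hq.1).trans hVcard
  have hι : #(T × ULift.{u} ℕ) ≤ ℵ₁ := by
    rw [← Cardinal.mul_def]
    exact (mul_le_mul' hTV (by simp)).trans_eq (Cardinal.mul_eq_self hω)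
  obtain ⟨ξ, hξinj, hξ⟩ := exists_injective_mem_of_mk_lt hι
    (fun i : T × ULift.{u} ℕ => {ξ | IsCondensationPoint i.1.1 ((t i.1).blade ξ)} \ Ex (t i.1)) (by
      intro i
      by_contra! hle
      refine ((Cardinal.mk_le_mk_of_subset ?_).trans
        (mk_union_le_of_le hω hle (hEx (t i.1)))).not_gt (ht i.1)
      exact fun ξ hξ => (em (ξ ∈ Ex (t i.1))).elim Or.inr fun h => Or.inl ⟨hξ, h⟩)
  let A : T × ULift.{u} ℕ → Set X := fun i => (t i.1).blade (ξ i)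
  have hAV : ∀ i, A i ⊆ V := fun i => ((h𝔉 _ (ht𝔉 i.1)).blade_subset _).trans
    (h𝔉 _ (ht𝔉 i.1)).carrier_subset
  have havoid : ∀ i j, (t i.1).Avoids (t j.1) → (A i ∩ A j).Countable := by
    intro i j h
    have h1 := (hξ i).2
    have h2 : ((t i.1).blade (ξ i) ∩ (t j.1).carrier).Countable := by
      by_contra hnc
      exact h1 (Set.mem_biUnion (show t j.1 ∈ {s ∈ 𝔉 | (t i.1).Avoids s} from ⟨ht𝔉 j.1, h⟩) hnc)
    exact h2.mono (Set.inter_subset_inter_right _ ((h𝔉 _ (ht𝔉 j.1)).blade_subset _))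
  have hAd : ∀ i j, i ≠ j → (A i ∩ A j).Countable := by
    intro i j hij
    by_cases h : t i.1 = t j.1
    · have := (h𝔉 _ (ht𝔉 i.1)).almostDisjoint (hξinj.ne hij)
      simp only [A, ← h]
      exact this
    · rcases (hc (ht𝔉 i.1) (ht𝔉 j.1) h).2 with h' | h'
      · exact havoid i j h'
      · rw [Set.inter_comm]
        exact havoid j i h'
  obtain ⟨g, hg, hgc⟩ := exists_injective_countable_initial hι
  let B : T × ULift.{u} ℕ → Set X := fun i => A i \ ⋃ j ∈ {j | g j < g i}, A j
  have hBd : ∀ i j, i ≠ j → Disjoint (B i) (B j) := by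
    have key : ∀ i j, g i < g j → Disjoint (B i) (B j) := fun i j h =>
      Set.disjoint_left.2 fun x hx hx' =>
        hx'.2 (Set.mem_biUnion (show i ∈ {i | g i < g j} from h) hx.1)
    intro i j hij
    rcases lt_or_gt_of_ne (hg.ne hij) with h | h
    · exact key i j h
    · exact (key j i h).symm
  have hBcl : ∀ i, i.1.1 ∈ closure (B i) := by
    intro i
    refine mem_closure_iff.2 fun W hW hqW => ?_
    have := sdiff_iUnion_initial_not_countable hgc (A := A) (i := i)
      (fun j hj => hAd i j fun h => hj.ne (congrArg g h.symm)) Set.inter_subset_right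
      ((hξ i).1 W hW hqW)
    by_contra hne
    exact this (Set.countable_empty.mono fun x hx => hne ⟨x, hx.1.1, hx.1.2, hx.2⟩)
  have hdense : ∀ n : ℕ, V ⊆ closure (⋃ q : T, B (q, ⟨n⟩)) := fun n =>
    hd.trans (closure_minimal (fun q hq => closure_mono
      (Set.subset_iUnion (fun q : T => B (q, ⟨n⟩)) ⟨q, hq⟩) (hBcl (⟨q, hq⟩, ⟨n⟩)))
      isClosed_closure)
  have hsub : ∀ n : ℕ, (⋃ q : T, B (q, ⟨n⟩)) ⊆ V := fun n =>
    Set.iUnion_subset fun q => Set.sdiff_subset.trans (hAV _)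
  refine ⟨fun n => ⋃ q : T, B (q, ⟨n⟩), hsub, ?_, fun m n hmn => ?_,
    fun m n => (hsub m).trans (hdense n)⟩
  · obtain ⟨q, hq⟩ := hV
    exact closure_nonempty_iff.1 ⟨q, hdense 0 hq⟩
  · refine Set.disjoint_iUnion_left.2 fun q => Set.disjoint_iUnion_right.2 fun q' => ?_
    exact hBd _ _ fun h => hmn (ULift.up_injective (Prod.ext_iff.1 h).2)

end CondensingFan

theorem containsResolvable_of_condensation [RegularSpace X] {V : Set X} (hV : IsOpen V)
    (hne : V.Nonempty) (hVcard : #V ≤ ℵ₁)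
    (hA : ∀ W ⊆ V, IsOpen W → W.Nonempty → ∃ A ⊆ W, ¬ A.Countable ∧
      ∀ B ⊆ A, ¬ B.Countable → ∃ q ∈ W, IsCondensationPoint q B) : ContainsResolvable V := by
  obtain ⟨𝔉, h𝔉, hc, hmax⟩ :=
    CondensingFan.exists_maximal_family (Order.succ (ℵ₁ : Cardinal.{u})).out V
  exact CondensingFan.containsResolvable_of_condensationSet hne hVcard h𝔉 hc
    (CondensingFan.subset_closure_condensationSet (Cardinal.mk_out _) hV hVcard hA h𝔉 hmax)

end Condensation

/-! ### The two cardinality cases and globalization. -/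

section Local

variable {X : Type u} [TopologicalSpace X]

theorem exists_not_dense_limitTower {e : X → Ordinal.{u}} {V : Set X} (hV : IsOpen V)
    (hne : V.Nonempty) (h : ¬ ContainsResolvable V) :
    ∃ n, V ⊆ closure (limitTower e V n) ∧ ∃ V' ⊆ V, IsOpen V' ∧ V'.Nonempty ∧
      Disjoint V' (limitTower e V (n + 1)) := by
  have hex : ∃ n, ¬ V ⊆ closure (limitTower e V n) := by
    by_contra! hall
    exact h (containsResolvable_of_dense_limitTower hV hne hall)
  classical
  obtain ⟨n, hn⟩ : ∃ n, Nat.find hex = n + 1 := by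
    refine Nat.exists_eq_succ_of_ne_zero fun h0 => ?_
    have := Nat.find_spec hex
    rw [h0] at this
    exact this subset_closure
  have hspec := Nat.find_spec hex
  rw [hn] at hspec
  obtain ⟨q, hq, hqT⟩ := Set.not_subset.1 hspec
  exact ⟨n, not_not.1 (Nat.find_min hex (hn ▸ Nat.lt_succ_self n)), _, Set.sdiff_subset,
    hV.sdiff isClosed_closure, ⟨q, hq, hqT⟩,
    Set.disjoint_left.2 fun x hx hx' => hx.2 (subset_closure hx')⟩

theorem exists_accPt_of_countableExtent {Y A B : Set X} (hY : HasCountableExtent Y) (hAY : A ⊆ Y)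
    (hBA : B ⊆ A) (hB : ¬ B.Countable) : ∃ q ∈ closure A, AccPt q (𝓟 B) := by
  obtain ⟨q, hq⟩ := hY (Subtype.val ⁻¹' B) fun hc => hB (by
    have := hc.image Subtype.val
    rwa [Subtype.image_preimage_coe, Set.inter_eq_right.2 (hBA.trans hAY)] at this)
  have hacc : AccPt q.1 (𝓟 B) := by
    rw [accPt_iff_nhds] at hq ⊢
    intro U hU
    obtain ⟨y, hy, hne⟩ := hq _ (continuous_subtype_val.continuousAt.preimage_mem_nhds hU)
    exact ⟨y.1, hy, fun h => hne (Subtype.ext h)⟩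
  exact ⟨q.1, closure_mono hBA (mem_closure_iff_clusterPt.2 hacc.clusterPt), hacc⟩

/-- At most one point of `B` other than `q` shares the rank of `q`, and in a `T₁` space it can be
removed from any neighbourhood of `q`. -/
theorem mem_closure_ne_rank [T1Space X] {A B : Set X} {e : X → Ordinal.{u}}
    (he : Set.InjOn e A) (hBA : B ⊆ A) {q : X} (hq : AccPt q (𝓟 B)) :
    q ∈ closure {b ∈ B | e b ≠ e q} := by
  refine mem_closure_iff.2 fun W hW hqW => ?_
  rw [accPt_iff_nhds] at hq
  by_cases h : ∃ b ∈ B, b ≠ q ∧ e b = e q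
  · obtain ⟨b, hb, hbq, heb⟩ := h
    obtain ⟨y, hy, hyq⟩ := hq _ ((hW.sdiff (isClosed_singleton (x := b))).mem_nhds
      ⟨hqW, fun h => hbq h.symm⟩)
    exact ⟨y, hy.1.1, hy.2, fun hey => hy.1.2 (he (hBA hy.2) (hBA hb) (hey.trans heb.symm))⟩
  · obtain ⟨y, hy, hyq⟩ := hq _ (hW.mem_nhds hqW)
    exact ⟨y, hy.1, hy.2, fun hey => h ⟨y, hy.2, hyq, hey⟩⟩

theorem containsResolvable_of_aleph_one_lt [T3Space X] (hgen : IsCountableExtentGenerated X)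
    {V : Set X} (hV : IsOpen V) (hne : V.Nonempty)
    (hbig : ∀ U ⊆ V, IsOpen U → U.Nonempty → ℵ₁ < #U) : ContainsResolvable V := by
  have hω : ℵ₀ ≤ (ℵ₁ : Cardinal.{u}) := Cardinal.aleph0_le_aleph 1
  by_contra hV'
  obtain ⟨e, he, hl⟩ := (containsResolvable_or_exists_rank hω V).resolve_left hV'
  obtain ⟨n, hn, V', hV'V, hV'o, hV'ne, hdisj⟩ := exists_not_dense_limitTower hV hne hV' (e := e)
  obtain ⟨Y, A, hY, hAY, hA, hinj, hcl, hsep⟩ :=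
    exists_uncountable_rank_discrete hgen hω he hl hbig hn hV'o hV'V hV'ne hdisj
  obtain ⟨B, hBA, hB⟩ := Cardinal.le_mk_iff_exists_subset.1 (aleph_one_le_mk_of_not_countable hA)
  obtain ⟨q, hq, hacc⟩ := exists_accPt_of_countableExtent hY hAY hBA
    fun hc => (countable_iff_mk_lt_aleph_one.1 hc).ne hB
  exact hsep q (hcl hq) B hBA hB.le (mem_closure_ne_rank hinj hBA hacc)

theorem containsResolvable_of_mk_le_aleph_one [T3Space X] (hgen : IsCountableExtentGenerated X)
    {V : Set X} (hV : IsOpen V) (hne : V.Nonempty) (hVcard : #V ≤ ℵ₁)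
    (hbig : ∀ U ⊆ V, IsOpen U → U.Nonempty → ℵ₀ < #U) : ContainsResolvable V := by
  by_contra hV'
  obtain ⟨e, he, hl⟩ := (containsResolvable_or_exists_rank le_rfl V).resolve_left hV'
  obtain ⟨n, hn, V', hV'V, hV'o, hV'ne, hdisj⟩ := exists_not_dense_limitTower hV hne hV' (e := e)
  refine hV' (.mono (containsResolvable_of_condensation hV'o hV'ne
    ((Cardinal.mk_le_mk_of_subset hV'V).trans hVcard) fun W hWV' hW hWne => ?_) hV'V)
  obtain ⟨Y, A, hY, hAY, hA, hinj, hcl, hsep⟩ :=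
    exists_uncountable_rank_discrete hgen le_rfl he hl hbig hn hW (hWV'.trans hV'V) hWne
      (hdisj.mono_left hWV')
  refine ⟨A, subset_closure.trans hcl, hA, fun B hBA hB => ?_⟩
  obtain ⟨q, hq, hacc⟩ := exists_accPt_of_countableExtent hY hAY hBA hB
  refine ⟨q, hcl hq, fun G hG hqG hc => ?_⟩
  -- A countable trace `G ∩ B` would be a small set accumulating at `q` through other ranks.
  refine hsep q (hcl hq) (G ∩ B) (Set.inter_subset_right.trans hBA)
    (Cardinal.le_aleph0_iff_set_countable.2 hc) ?_
  refine mem_closure_iff.2 fun W' hW' hqW' => ?_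
  obtain ⟨x, hx, hxB, hxe⟩ := mem_closure_iff.1 (mem_closure_ne_rank hinj hBA hacc) _
    (hW'.inter hG) ⟨hqW', hqG⟩
  exact ⟨x, hx.1, ⟨hx.2, hxB⟩, hxe⟩

theorem containsResolvable_of_isOpen [T3Space X] (hgen : IsCountableExtentGenerated X)
    (hΔ : ∀ U : Set X, IsOpen U → U.Nonempty → ℵ₀ < #U) {V : Set X} (hV : IsOpen V)
    (hne : V.Nonempty) : ContainsResolvable V := by
  by_cases h : ∃ U ⊆ V, IsOpen U ∧ U.Nonempty ∧ #U ≤ ℵ₁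
  · obtain ⟨U, hUV, hU, hUne, hUcard⟩ := h
    exact (containsResolvable_of_mk_le_aleph_one hgen hU hUne hUcard fun W _ => hΔ W).mono hUV
  · push Not at h
    exact containsResolvable_of_aleph_one_lt hgen hV hne h

theorem isResolvable_of_dense_sequence [Nonempty X] {E : ℕ → Set X} (hE : ∀ i, Dense (E i))
    (hd : Pairwise (Function.onFun Disjoint E)) : IsResolvable ℵ₀ X := by
  have hinj : Function.Injective E := by
    intro i j h
    by_contra hne
    have := hd hne
    rw [Function.onFun, h, disjoint_self] at this
    exact (hE j).nonempty.ne_empty this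
  refine ⟨Set.range E, ?_, ?_, ?_⟩
  · simpa using Cardinal.mk_range_eq_of_injective hinj
  · rintro _ ⟨i, rfl⟩
    exact hE i
  · rintro _ ⟨i, rfl⟩ _ ⟨j, rfl⟩ hne
    exact hd fun h => hne (h ▸ rfl)

/-- A maximal disjoint family of piece sequences has dense union; gluing the `n`-th pieces over the
family gives the `n`-th dense set. -/
theorem isResolvable_of_containsResolvable [Nonempty X]
    (h : ∀ V : Set X, IsOpen V → V.Nonempty → ContainsResolvable V) : IsResolvable ℵ₀ X := by
  let 𝒮 : Set (Set (ℕ → Set X)) := {𝒜 | (∀ E ∈ 𝒜, (E 0).Nonempty ∧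
    Pairwise (Function.onFun Disjoint E) ∧ ∀ i j, E i ⊆ closure (E j)) ∧
    𝒜.Pairwise fun E F => Disjoint (⋃ i, E i) (⋃ i, F i)}
  obtain ⟨𝒜, hmax⟩ := zorn_subset 𝒮 fun c hc hchain =>
    ⟨⋃₀ c, ⟨fun s ⟨t, ht, hs⟩ => (hc ht).1 s hs,
      (Set.pairwise_sUnion hchain.directedOn).2 fun t ht => (hc ht).2⟩,
      fun s hs => Set.subset_sUnion_of_mem hs⟩
  have h𝒜 := hmax.prop
  have hdense : Dense (⋃ E ∈ 𝒜, ⋃ i, E i) := by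
    by_contra hnd
    obtain ⟨E, hEV, hE⟩ := h (closure (⋃ E ∈ 𝒜, ⋃ i, E i))ᶜ isClosed_closure.isOpen_compl
      (Set.nonempty_compl.2 fun h => hnd (dense_iff_closure_eq.2 h))
    have hdisj : ∀ F ∈ 𝒜, Disjoint (⋃ i, E i) (⋃ i, F i) := fun F hF =>
      Set.disjoint_left.2 fun x hx hx' =>
        Set.iUnion_subset hEV hx (subset_closure (Set.mem_biUnion hF hx'))
    have hmem : E ∈ 𝒜 := by
      refine hmax.le_of_ge (y := insert E 𝒜) ⟨?_, ?_⟩ (Set.subset_insert _ _)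
        (Set.mem_insert _ _)
      · rintro F (rfl | hF)
        · exact hE
        · exact h𝒜.1 F hF
      · exact h𝒜.2.insert fun F hF _ => ⟨hdisj F hF, (hdisj F hF).symm⟩
    obtain ⟨x, hx⟩ := hE.1
    have hx' := Set.mem_iUnion_of_mem 0 hx
    exact Set.disjoint_left.1 (hdisj E hmem) hx' hx'
  refine isResolvable_of_dense_sequence (E := fun n => ⋃ E ∈ 𝒜, E n) (fun n => ?_)
    fun m n hmn => ?_
  · refine dense_closure.1 (hdense.mono (Set.iUnion₂_subset fun E hE => Set.iUnion_subset fun i => ?_))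
    exact ((h𝒜.1 E hE).2.2 i n).trans
      (closure_mono (Set.subset_biUnion_of_mem (u := fun E : ℕ → Set X => E n) hE))
  · refine Set.disjoint_iUnion₂_left.2 fun E hE => Set.disjoint_iUnion₂_right.2 fun F hF => ?_
    by_cases hEF : E = F
    · exact hEF ▸ (h𝒜.1 E hE).2.1 hmn
    · exact (h𝒜.2 hE hF hEF).mono (Set.subset_iUnion _ _) (Set.subset_iUnion _ _)

theorem aleph0_lt_mk_of_isOpen (hΔ : ℵ₀ < dispersionCharacter X) {U : Set X} (hU : IsOpen U)
    (hne : U.Nonempty) : ℵ₀ < #U :=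
  hΔ.trans_le (csInf_le' ⟨U, hU, hne, rfl⟩)

theorem nonempty_of_dispersionCharacter (hΔ : ℵ₀ < dispersionCharacter X) : Nonempty X := by
  by_contra hX
  have hempty : {c : Cardinal.{u} | ∃ U : Set X, IsOpen U ∧ U.Nonempty ∧ #U = c} = ∅ :=
    Set.eq_empty_of_forall_notMem fun c ⟨_, _, ⟨x, _⟩, _⟩ => hX ⟨x⟩
  rw [dispersionCharacter, hempty, Cardinal.sInf_empty] at hΔ
  exact not_lt_zero hΔ

end Local

theorem theorem3p1 (X : Type u) [TopologicalSpace X] [T3Space X]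
    (hgen : IsCountableExtentGenerated X) (hΔ : ℵ₀ < dispersionCharacter X) :
    IsResolvable ℵ₀ X := by
  have := nonempty_of_dispersionCharacter hΔ
  exact isResolvable_of_containsResolvable fun V hV hne =>
    containsResolvable_of_isOpen hgen (fun U => aleph0_lt_mk_of_isOpen hΔ) hV hne
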